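/- An infinite step billiard is the billiard in a table $P=\bigcup_{n\ge 0}[n,n+1]\times[0,p_n]$, where $1=p_0\ge p_1\ge p_2\ge\dots$, $p_n>0$ for all $n$ and $p_n\to 0$: a point moves with unit speed in $P$ and is reflected elastically at the sides. For $\vartheta\in(0,\pi/2)$, the trajectories whose velocities are of the form $(\pm\cos\vartheta,\pm\sin\vartheta)$ are described, by unfolding, on the invariant surface $S(\vartheta)$. This is the region $\{(X,Y):(|X|,|Y|)\in P\}$ with sides glued as follows: $(X,p_n)\sim(X,-p_n)$ for $n\le|X|\le n+1$, $n\ge 0$, and $(n,Y)\sim(-n,Y)$ for $n\ge1$, $p_n\le|Y|\le p_{n-1}$. The flow $\phi_t$ $(t\in\mathbb R)$ on $S(\vartheta)$ moves points with constant velocity $(\cos\vartheta,\sin\vartheta)$, and the position on the table is $(|X|,|Y|)$. A trajectory that hits a singular vertex (one of the points $(\pm n,\pm p_n)$, $n\ge1$) is continued as the limit of the parallel trajectories immediately above it in the coordinates $(X,Y)$ (vertical cross-sections are half-open intervals, closed below and open above, and a singular vertex is counted as several points, one for each trajectory that leaves it). So every trajectory is defined for all $t\in\mathbb R$. A trajectory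 is periodic if it returns to its initial point of $S(\vartheta)$ after some time $T>0$. A trajectory, or a forward ($t\ge0$) or backward ($t\le 0$) semi-orbit, is unbounded if its set of positions is unbounded in the plane. Proposition. (a) For every infinite step billiard and for Lebesgue-almost every direction $\vartheta\in(0,\pi/2)$, all semi-orbits, forward and backward, of all points of $S(\vartheta)$ are unbounded. (b) For every infinite step billiard, the set of directions $\vartheta\in(0,\pi/2)$ in which there are both a periodic trajectory and an unbounded trajectory has Lebesgue measure zero. (c) Such coexistence does occur: there are an infinite step billiard and a direction $\vartheta\in(0,\pi/2)$ in which there are both a periodic trajectory and an unbounded trajectory. -/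

import Mathlib

open MeasureTheory Set Filter Topology

/-- An infinite step billiard, given by a sequence of heights `1 = p 0 ≥ p 1 ≥ p 2 ≥ ⋯ > 0`
that tends to `0`. -/
structure StepBilliard where
  p : ℕ → ℝ
  p_zero : p 0 = 1
  p_pos : ∀ n, 0 < p n
  p_antitone : Antitone p
  p_tendsto : Tendsto p atTop (𝓝 0)

noncomputable section

namespace StepBilliard

variable (B : StepBilliard)

/-- The table `⋃ n, [n, n + 1] × [0, p n]`. -/
def table : Set (ℝ × ℝ) :=
  ⋃ n : ℕ, Icc (n : ℝ) (n + 1) ×ˢ Icc 0 (B.p n)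

/-- For `k ∈ ℤ`, the height of the table over the image `[n, n + 1]` of `[k, k + 1]` under
`X ↦ |X|`: here `n = k` if `0 ≤ k`, and `n = -k - 1` if `k < 0`. -/
def height : ℤ → ℝ
  | Int.ofNat n => B.p n
  | Int.negSucc n => B.p n

/-- The interval `[-h, h)`, where `h` is the height of the table over the column
`k ≤ |X| ≤ k + 1`. The points with ordinates `h` and `-h` are identified. -/
def fiber (k : ℤ) : Set ℝ := Ico (-B.height k) (B.height k)

theorem height_pos (k : ℤ) : 0 < B.height k := by
  cases k <;> exact B.p_pos _

theorem height_neg (j : ℤ) : B.height (-j) = B.height (j - 1) := by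
  rcases j with (_ | n) | n
  · show B.p 0 = B.p 0
    rfl
  · have h1 : -(Int.ofNat (n + 1)) = Int.negSucc n := rfl
    have h2 : Int.ofNat (n + 1) - 1 = Int.ofNat n := by simp
    rw [h1, h2]
    rfl
  · have h1 : -(Int.negSucc n) = Int.ofNat (n + 1) := rfl
    have h2 : Int.negSucc n - 1 = Int.negSucc (n + 1) := rfl
    rw [h1, h2]
    rfl

theorem fiber_neg (j : ℤ) : B.fiber (-j) = B.fiber (j - 1) := by
  simp only [fiber, height_neg]

theorem fiber_neg_sub_one (j : ℤ) : B.fiber (-j - 1) = B.fiber j := by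
  rw [show -j - 1 = -(j + 1) by ring, fiber_neg]
  simp

/-- The representative in `[-h, h)` of a real number modulo `2 * h`, where `h` is the height of
the `k`-th column: the horizontal sides at ordinates `h` and `-h` are glued by translation. -/
def wrap (k : ℤ) (y : ℝ) : ℝ :=
  toIcoMod (mul_pos two_pos (B.height_pos k)) (-B.height k) y

theorem wrap_mem (k : ℤ) (y : ℝ) : B.wrap k y ∈ B.fiber k := by
  have h := toIcoMod_mem_Ico (mul_pos two_pos (B.height_pos k)) (-B.height k) y
  rwa [show -B.height k + 2 * B.height k = B.height k by ring] at h

theorem wrap_of_mem {k : ℤ} {y : ℝ} (hy : y ∈ B.fiber k) : B.wrap k y = y := by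
  rw [wrap, toIcoMod_eq_self, show -B.height k + 2 * B.height k = B.height k by ring]
  exact hy

theorem wrap_wrap_add (k : ℤ) (y a : ℝ) : B.wrap k (B.wrap k y + a) = B.wrap k (y + a) := by
  simp only [wrap]
  rw [toIcoMod_eq_toIcoMod]
  refine ⟨toIcoDiv (mul_pos two_pos (B.height_pos k)) (-B.height k) y, ?_⟩
  rw [toIcoMod]
  ring

/-- The invariant surface: the four reflected copies `{(X, Y) | (|X|, |Y|) ∈ table}` of the
table, with opposite sides glued by translation: `(X, p n)` with `(X, -p n)` for
`n ≤ |X| ≤ n + 1`, and `(n, Y)` with `(-n, Y)` for `n ≥ 1`, `p n ≤ |Y| ≤ p (n - 1)`.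

The point `(X, Y)` stands for the position `(|X|, |Y|)` together with one of the four directions
`(± cos θ, ± sin θ)`: the horizontal sign is `+` if `0 ≤ X` and `-` if `X < 0`, the vertical
sign is `+` if `0 ≤ Y` and `-` if `Y < 0`. In these coordinates the motion always has velocity
`(cos θ, sin θ)`, and a reflection at `x = 0` or `y = 0` becomes a passage through `X = 0` or
`Y = 0`, while reflections at the other sides become passages through glued sides.
Of two glued side points the representative from
which the motion with that velocity stays in the region is chosen: a top side is replaced by the
bottom side, and the right-hand wall `{n} × ±[p n, p (n - 1)]` by the left-hand wall
`{-n} × ±[p n, p (n - 1)]`. (A singular vertex is thereby represented by three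
points, `(n, -p n)`, `(-n, p n)` and `(-n, -p n)`, one for each trajectory that leaves it.) -/
def Surface : Type := {z : ℝ × ℝ // z.2 ∈ B.fiber ⌊z.1⌋}

variable {B} in
/-- The position on the table of a point of the invariant surface. -/
def Surface.position (z : B.Surface) : ℝ × ℝ := (|z.1.1|, |z.1.2|)

theorem position_mem_table (z : B.Surface) : z.position ∈ B.table := by
  obtain ⟨⟨X, Y⟩, hz⟩ := z
  have hz' : Y ∈ B.fiber ⌊X⌋ := hz
  have h1 : |Y| ≤ B.height ⌊X⌋ := abs_le.mpr ⟨hz'.1, hz'.2.le⟩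
  have h2 := Int.floor_le X
  have h3 := (Int.lt_floor_add_one X).le
  revert h1 h2 h3
  generalize ⌊X⌋ = k
  intro h1 h2 h3
  rcases k with n | n
  · have h0 : (0 : ℝ) ≤ n := n.cast_nonneg
    simp only [Int.ofNat_eq_natCast, Int.cast_natCast] at h2 h3
    refine mem_iUnion.mpr ⟨n, ⟨?_, ?_⟩, abs_nonneg Y, h1⟩ <;>
      simp only [Surface.position] <;> rw [abs_of_nonneg (h0.trans h2)] <;> assumption
  · have h0 : (0 : ℝ) ≤ n := n.cast_nonneg
    rw [Int.cast_negSucc] at h2 h3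
    push_cast at h2 h3
    refine mem_iUnion.mpr ⟨n, ⟨?_, ?_⟩, abs_nonneg Y, h1⟩ <;>
      simp only [Surface.position] <;> rw [abs_of_nonpos (by linarith)] <;> linarith

/-- The left edges `{k} × [-h, h)` of the columns `[k, k + 1] × [-h, h)` of the surface. -/
def LeftEdge : Type := {c : ℤ × ℝ // c.2 ∈ B.fiber c.1}

/-- The right edges of the columns; `(j, y)` lies on the right edge of the column that ends at
abscissa `j`. -/
def RightEdge : Type := {c : ℤ × ℝ // c.2 ∈ B.fiber (c.1 - 1)}

/-- Straight motion of slope `tan θ` across a column, from its left edge to its right edge. -/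
def traverse (θ : ℝ) : B.LeftEdge ≃ B.RightEdge where
  toFun c := ⟨(c.1.1 + 1, B.wrap c.1.1 (c.1.2 + Real.tan θ)), by
    simpa using B.wrap_mem c.1.1 (c.1.2 + Real.tan θ)⟩
  invFun c := ⟨(c.1.1 - 1, B.wrap (c.1.1 - 1) (c.1.2 - Real.tan θ)),
    B.wrap_mem (c.1.1 - 1) (c.1.2 - Real.tan θ)⟩
  left_inv := by
    rintro ⟨⟨k, y⟩, hy⟩
    apply Subtype.ext
    simp only [add_sub_cancel_right, sub_eq_add_neg (B.wrap _ _), wrap_wrap_add,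
      add_neg_cancel_right]
    rw [B.wrap_of_mem hy]
  right_inv := by
    rintro ⟨⟨k, y⟩, hy⟩
    apply Subtype.ext
    simp only [wrap_wrap_add, sub_add_cancel]
    rw [B.wrap_of_mem hy]

/-- Passage from the right edge of a column to the left edge of a column, at abscissa `j`. If the
next column is open at height `y`, the point moves on into it; otherwise it hits the vertical
wall at abscissa `j`, which is glued to the wall at abscissa `-j`. At a singular vertex this is
the limit from above: the intervals `[-h, h)` are closed below and open above. -/
def glue : B.RightEdge ≃ B.LeftEdge where
  toFun c :=
    open Classical in
    ⟨(if c.1.2 ∈ B.fiber c.1.1 then c.1.1 else -c.1.1, c.1.2), by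
      split_ifs with h
      · exact h
      · exact (B.fiber_neg c.1.1).symm ▸ c.2⟩
  invFun c :=
    open Classical in
    ⟨(if c.1.2 ∈ B.fiber (c.1.1 - 1) then c.1.1 else -c.1.1, c.1.2), by
      split_ifs with h
      · exact h
      · exact (B.fiber_neg_sub_one c.1.1).symm ▸ c.2⟩
  left_inv := by
    rintro ⟨⟨j, y⟩, hy⟩
    have hy' : y ∈ B.fiber (j - 1) := hy
    apply Subtype.ext
    by_cases h : y ∈ B.fiber j <;> simp [h, hy', fiber_neg_sub_one]
  right_inv := by
    rintro ⟨⟨j, y⟩, hy⟩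
    have hy' : y ∈ B.fiber j := hy
    apply Subtype.ext
    by_cases h : y ∈ B.fiber (j - 1) <;> simp [h, hy', fiber_neg]

/-- The motion in direction `θ` from the left edge of a column to the left edge of the column
that is entered next. -/
def cross (θ : ℝ) : Equiv.Perm B.LeftEdge := (B.traverse θ).trans B.glue

/-- The billiard flow at time `t` on the invariant surface of direction `θ ∈ (0, π / 2)`: motion
with velocity `(cos θ, sin θ)` and the gluings above. The point `(X, Y)` is first moved back
along its trajectory to the left edge of its column; from there the abscissa has to
increase by `u = (X - ⌊X⌋) + t cos θ`, that is, `⌊u⌋` columns are crossed (backwards if `u < 0`)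
and the abscissa then increases by the remaining `u - ⌊u⌋ ∈ [0, 1)`. -/
def flow (θ t : ℝ) (z : B.Surface) : B.Surface :=
  let u : ℝ := Int.fract z.1.1 + t * Real.cos θ
  let start : B.LeftEdge :=
    ⟨(⌊z.1.1⌋, B.wrap ⌊z.1.1⌋ (z.1.2 - Int.fract z.1.1 * Real.tan θ)), B.wrap_mem _ _⟩
  let c : B.LeftEdge := (B.cross θ ^ ⌊u⌋) start
  ⟨((c.1.1 : ℝ) + Int.fract u, B.wrap c.1.1 (c.1.2 + Int.fract u * Real.tan θ)), by
    have h : ⌊(c.1.1 : ℝ) + Int.fract u⌋ = c.1.1 := by simp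
    simpa only [h] using B.wrap_mem c.1.1 (c.1.2 + Int.fract u * Real.tan θ)⟩

/-- The forward semi-orbit, as a subset of the table. -/
def forwardSemiOrbit (θ : ℝ) (z : B.Surface) : Set (ℝ × ℝ) :=
  (fun t : ℝ => (B.flow θ t z).position) '' Ici 0

/-- The backward semi-orbit, as a subset of the table. -/
def backwardSemiOrbit (θ : ℝ) (z : B.Surface) : Set (ℝ × ℝ) :=
  (fun t : ℝ => (B.flow θ t z).position) '' Iic 0

/-- The whole trajectory, as a subset of the table. -/
def trajectory (θ : ℝ) (z : B.Surface) : Set (ℝ × ℝ) :=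
  range fun t : ℝ => (B.flow θ t z).position

/-- The trajectory of `z` in direction `θ` is periodic. -/
def IsPeriodic (θ : ℝ) (z : B.Surface) : Prop :=
  ∃ T : ℝ, 0 < T ∧ B.flow θ T z = z

/-- In direction `θ` there are both a periodic and an unbounded trajectory. -/
def PeriodicUnboundedCoexist (θ : ℝ) : Prop :=
  (∃ z : B.Surface, B.IsPeriodic θ z) ∧
    ∃ w : B.Surface, ¬ Bornology.IsBounded (B.trajectory θ w)

end StepBilliard

end

/-! Record a trajectory by its crossings of the left edges of columns, and let G be the countable
group generated by the heights. Each crossing adds `tan θ` to the ordinate modulo G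
(`cross_zpow_sub_mem`). Call θ free if no nonzero integer multiple of `tan θ` lies in G; all but
countably many θ are free. In a free direction ordinates at distinct times differ modulo G. Hence no
trajectory closes up, which gives (b), and an orbit has an ordinate in G at most once, so at least
one half of it avoids every singularity.

For (a), suppose that in a free direction a semi-orbit stays in finitely many columns, and let Ω be
its set of accumulation points in the open fibers. It is nonempty: otherwise all accumulation points
have ordinates in G, and comparing two consecutive ones puts `tan θ` in G. If Ω met a fiber without
filling it, some point of Ω would be an end point of a gap of Ω. Carry the gap along the regular
half of the orbit of that point. Only finitely many singularities exist in the columns concerned,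
and each can shorten the gap at most once, so infinitely many disjoint gaps of one fixed length
would fit into a bounded set (`not_isGap_of_orbit`). Hence Ω fills every fiber that it meets. A full
fiber sends points into the next column to the right, so Ω reaches every column further right, a
contradiction.

For (c), heights 2⁻ⁿ and slope 1 allow explicit orbits. -/

noncomputable section

namespace StepBilliard

variable (B : StepBilliard)

/-! ### Ordinates modulo the group of heights. -/

/-- The additive group generated by the heights of a step billiard. -/
def heightGroup : AddSubgroup ℝ :=
  (Finsupp.linearCombination ℤ B.p).toAddMonoidHom.range

theorem countable_heightGroup : (B.heightGroup : Set ℝ).Countable :=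
  countable_range (Finsupp.linearCombination ℤ B.p)

theorem height_mem_heightGroup (k : ℤ) : B.height k ∈ B.heightGroup := by
  cases k with
  | ofNat n => exact ⟨Finsupp.single n 1, by simp [height]⟩
  | negSucc n => exact ⟨Finsupp.single n 1, by simp [height]⟩

theorem height_le_one (k : ℤ) : B.height k ≤ 1 := by
  rw [← B.p_zero]
  cases k <;> exact B.p_antitone (Nat.zero_le _)

theorem wrap_sub_mem_zmultiples (k : ℤ) (y : ℝ) :
    B.wrap k y - y ∈ AddSubgroup.zmultiples (2 * B.height k) := by
  refine ⟨-toIcoDiv (mul_pos two_pos (B.height_pos k)) (-B.height k) y, ?_⟩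
  simp only [wrap, toIcoMod, neg_smul]
  ring

theorem zmultiples_le_heightGroup (k : ℤ) :
    AddSubgroup.zmultiples (2 * B.height k) ≤ B.heightGroup := by
  rw [AddSubgroup.zmultiples_le, two_mul]
  exact add_mem (B.height_mem_heightGroup k) (B.height_mem_heightGroup k)

theorem wrap_sub_mem (k : ℤ) (y : ℝ) : B.wrap k y - y ∈ B.heightGroup :=
  B.zmultiples_le_heightGroup k (B.wrap_sub_mem_zmultiples k y)

/-- Away from the closed end of the fiber, the multiple of `2 * B.height k` that brings `y` into the
fiber also works for all nearby points. -/
theorem wrap_eventually_eq {k : ℤ} {y : ℝ} (h : B.wrap k y ≠ -B.height k) :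
    ∀ᶠ y' in 𝓝 y, B.wrap k y' = y' + (B.wrap k y - y) := by
  obtain ⟨m, hm⟩ := B.wrap_sub_mem_zmultiples k y
  have h1 := B.wrap_mem k y
  have h2 : ∀ᶠ y' in 𝓝 y, y' + (B.wrap k y - y) ∈ Ioo (-B.height k) (B.height k) := by
    refine (continuous_id.add continuous_const).continuousAt.eventually_mem ?_
    simpa using Ioo_mem_nhds (lt_of_le_of_ne h1.1 h.symm) h1.2
  filter_upwards [h2] with y' hy'
  rw [← B.wrap_of_mem (Ioo_subset_Ico_self hy'), ← hm]
  simp only [wrap]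
  rw [toIcoMod_eq_toIcoMod]
  exact ⟨m, by simp⟩

theorem eventually_mem_fiber_iff {k : ℤ} {y : ℝ} (h1 : y ≠ -B.height k) (h2 : y ≠ B.height k) :
    ∀ᶠ y' in 𝓝 y, (y' ∈ B.fiber k ↔ y ∈ B.fiber k) := by
  simp only [fiber, mem_Ico]
  rcases h1.lt_or_gt with h1 | h1
  · filter_upwards [eventually_lt_nhds h1] with y' h'
    simp [h1.not_ge, h'.not_ge]
  rcases h2.lt_or_gt with h2 | h2
  · filter_upwards [eventually_lt_nhds h2, eventually_gt_nhds h1] with y' h' h''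
    simp [h1.le, h2, h', h''.le]
  · filter_upwards [eventually_gt_nhds h2] with y' h'
    simp [h2.not_gt, h'.not_gt]

/-! ### The crossing map and its inverse on pairs. -/

/-- The open columns: the points of left edges off the end points of the fibers. -/
def openFibers : Set (ℤ × ℝ) := {b | |b.2| < B.height b.1}

variable {B} in
theorem mem_fiber_of_mem_openFibers {b : ℤ × ℝ} (h : b ∈ B.openFibers) : b.2 ∈ B.fiber b.1 :=
  ⟨(abs_lt.mp h).1.le, (abs_lt.mp h).2⟩

theorem mem_openFibers_of_mem_fiber {k : ℤ} {y : ℝ} (h : y ∈ B.fiber k)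
    (h' : y ≠ -B.height k) : (k, y) ∈ B.openFibers :=
  abs_lt.mpr ⟨lt_of_le_of_ne h.1 h'.symm, h.2⟩

/-- The map `cross` on pairs. -/
def crossMap (θ : ℝ) (b : ℤ × ℝ) : ℤ × ℝ :=
  open Classical in
  (if B.wrap b.1 (b.2 + Real.tan θ) ∈ B.fiber (b.1 + 1) then b.1 + 1 else -(b.1 + 1),
    B.wrap b.1 (b.2 + Real.tan θ))

/-- The column entered when crossing abscissa `j` backwards at height `y`. -/
def backColumn (j : ℤ) (y : ℝ) : ℤ :=
  open Classical in (if y ∈ B.fiber (j - 1) then j else -j) - 1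

/-- The inverse of `cross` on pairs. -/
def crossInvMap (θ : ℝ) (b : ℤ × ℝ) : ℤ × ℝ :=
  (B.backColumn b.1 b.2, B.wrap (B.backColumn b.1 b.2) (b.2 - Real.tan θ))

theorem coe_cross (θ : ℝ) (c : B.LeftEdge) : (B.cross θ c).1 = B.crossMap θ c.1 := rfl

theorem coe_cross_symm (θ : ℝ) (c : B.LeftEdge) :
    ((B.cross θ).symm c).1 = B.crossInvMap θ c.1 := rfl

theorem crossInvMap_crossMap (θ : ℝ) {b : ℤ × ℝ} (hb : b.2 ∈ B.fiber b.1) :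
    B.crossInvMap θ (B.crossMap θ b) = b :=
  congrArg Subtype.val ((B.cross θ).symm_apply_apply ⟨b, hb⟩)

theorem crossMap_crossInvMap (θ : ℝ) {b : ℤ × ℝ} (hb : b.2 ∈ B.fiber b.1) :
    B.crossMap θ (B.crossInvMap θ b) = b :=
  congrArg Subtype.val ((B.cross θ).apply_symm_apply ⟨b, hb⟩)

theorem coe_cross_zpow_add_one (θ : ℝ) (i : ℤ) (c : B.LeftEdge) :
    ((B.cross θ ^ (i + 1)) c).1 = B.crossMap θ ((B.cross θ ^ i) c).1 := by
  rw [add_comm, zpow_add, zpow_one, Equiv.Perm.mul_apply, coe_cross]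

theorem coe_cross_zpow_sub_one (θ : ℝ) (i : ℤ) (c : B.LeftEdge) :
    ((B.cross θ ^ (i - 1)) c).1 = B.crossInvMap θ ((B.cross θ ^ i) c).1 := by
  rw [sub_eq_neg_add, zpow_add, zpow_neg_one, Equiv.Perm.mul_apply]
  exact B.coe_cross_symm θ _

/-- Wrapping changes an ordinate by an element of the group and gluing does not change it, so only
the rise `tan θ` per column remains modulo the group. -/
theorem cross_zpow_sub_mem (θ : ℝ) (i : ℤ) (c : B.LeftEdge) :
    ((B.cross θ ^ i) c).1.2 - c.1.2 - i * Real.tan θ ∈ B.heightGroup := by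
  have step : ∀ i : ℤ, ((B.cross θ ^ (i + 1)) c).1.2 - ((B.cross θ ^ i) c).1.2 - Real.tan θ
      ∈ B.heightGroup := by
    intro i
    rw [coe_cross_zpow_add_one]
    have := B.wrap_sub_mem ((B.cross θ ^ i) c).1.1 (((B.cross θ ^ i) c).1.2 + Real.tan θ)
    rwa [← sub_sub] at this
  induction i using Int.induction_on with
  | zero => simp
  | succ i ih =>
    have := add_mem ih (step i)
    push_cast at this ⊢
    convert this using 1
    ring
  | pred i ih =>
    have := sub_mem ih (step (-i - 1))
    rw [sub_add_cancel] at this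
    push_cast at this ⊢
    convert this using 1
    ring

/-! ### Local translations and the finiteness of singularities. -/

/-- Near the point `b` of its fiber, the map `f` is a translation into an open fiber. -/
def IsTranslationAt (f : ℤ × ℝ → ℤ × ℝ) (b : ℤ × ℝ) : Prop :=
  ∃ (j : ℤ) (c : ℝ), ∀ᶠ y in 𝓝 b.2, f (b.1, y) = (j, y + c) ∧ (j, y + c) ∈ B.openFibers

theorem eventually_mem_openFibers {b : ℤ × ℝ} (hb : b ∈ B.openFibers) :
    ∀ᶠ y in 𝓝 b.2, (b.1, y) ∈ B.openFibers :=
  (continuous_abs.tendsto b.2).eventually_lt_const hb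

theorem isTranslationAt_of_eventually {f : ℤ × ℝ → ℤ × ℝ} {b : ℤ × ℝ} (j : ℤ) (c : ℝ)
    (h : ∀ᶠ y in 𝓝 b.2, f (b.1, y) = (j, y + c)) (hb : (j, b.2 + c) ∈ B.openFibers) :
    B.IsTranslationAt f b := by
  refine ⟨j, c, h.and ?_⟩
  have : Tendsto (fun y : ℝ => y + c) (𝓝 b.2) (𝓝 (b.2 + c)) :=
    (continuous_id.add continuous_const).tendsto b.2
  exact this.eventually (B.eventually_mem_openFibers hb)

theorem isTranslationAt_crossMap {θ : ℝ} {b : ℤ × ℝ}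
    (h0 : (B.crossMap θ b).2 ≠ -B.height b.1)
    (h1 : (B.crossMap θ b).2 ≠ -B.height (b.1 + 1))
    (h2 : (B.crossMap θ b).2 ≠ B.height (b.1 + 1)) :
    B.IsTranslationAt (B.crossMap θ) b := by
  obtain ⟨k, y⟩ := b
  simp only [crossMap] at h0 h1 h2
  have hc : Tendsto (fun y' : ℝ => y' + Real.tan θ) (𝓝 y) (𝓝 (y + Real.tan θ)) :=
    (continuous_id.add continuous_const).tendsto y
  have hw := hc.eventually (B.wrap_eventually_eq h0)
  have hf : ∀ᶠ y' in 𝓝 y, (B.wrap k (y' + Real.tan θ) ∈ B.fiber (k + 1) ↔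
      B.wrap k (y + Real.tan θ) ∈ B.fiber (k + 1)) := by
    have hd : Tendsto (fun y' : ℝ => y' + Real.tan θ + (B.wrap k (y + Real.tan θ) - (y + Real.tan θ)))
        (𝓝 y) (𝓝 (B.wrap k (y + Real.tan θ))) := by
      have := hc.add_const (B.wrap k (y + Real.tan θ) - (y + Real.tan θ))
      rwa [add_sub_cancel] at this
    filter_upwards [hw, hd.eventually (B.eventually_mem_fiber_iff h1 h2)] with y' e1 e2
    rw [e1]
    exact e2
  refine B.isTranslationAt_of_eventually (B.crossMap θ (k, y)).1
    (B.wrap k (y + Real.tan θ) - y) ?_ ?_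
  · filter_upwards [hw, hf] with y' e1 e2
    classical
    refine Prod.ext (if_congr e2 rfl rfl) (e1.trans ?_)
    show _ = _
    ring
  · rw [add_sub_cancel]
    simp only [crossMap]
    split_ifs with h
    · exact B.mem_openFibers_of_mem_fiber h h1
    -- After hitting the wall the point enters column `-(k + 1)`, which has the height of column
    -- `k`.
    · have e := B.height_neg (k + 1)
      rw [add_sub_cancel_right] at e
      refine B.mem_openFibers_of_mem_fiber ?_ (by rwa [e])
      rw [fiber, e]
      exact B.wrap_mem k _

theorem isTranslationAt_crossInvMap {θ : ℝ} {b : ℤ × ℝ}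
    (h0 : (B.crossInvMap θ b).2 ≠ -B.height (B.crossInvMap θ b).1)
    (h1 : b.2 ≠ -B.height (b.1 - 1)) (h2 : b.2 ≠ B.height (b.1 - 1)) :
    B.IsTranslationAt (B.crossInvMap θ) b := by
  obtain ⟨k, y⟩ := b
  simp only [crossInvMap] at h0 h1 h2
  have hc : Tendsto (fun y' : ℝ => y' - Real.tan θ) (𝓝 y) (𝓝 (y - Real.tan θ)) :=
    (continuous_id.sub continuous_const).tendsto y
  have hw := hc.eventually (B.wrap_eventually_eq h0)
  have hf : ∀ᶠ y' in 𝓝 y, B.backColumn k y' = B.backColumn k y := by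
    filter_upwards [B.eventually_mem_fiber_iff h1 h2] with y' e
    classical
    exact congrArg (· - 1) (if_congr e rfl rfl)
  refine B.isTranslationAt_of_eventually (B.backColumn k y)
    (B.wrap (B.backColumn k y) (y - Real.tan θ) - y) ?_ ?_
  · filter_upwards [hw, hf] with y' e1 e2
    simp only [crossInvMap, e2]
    rw [e1]
    ext1
    · rfl
    · show _ = _
      ring
  · rw [add_sub_cancel]
    exact B.mem_openFibers_of_mem_fiber (B.wrap_mem _ _) h0

theorem isTranslationAt_crossMap_of_notMem {θ : ℝ} {b : ℤ × ℝ}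
    (h : (B.crossMap θ b).2 ∉ B.heightGroup) : B.IsTranslationAt (B.crossMap θ) b := by
  have hG : ∀ k, (B.crossMap θ b).2 ≠ B.height k ∧ (B.crossMap θ b).2 ≠ -B.height k := fun k =>
    ⟨fun e => h (e ▸ B.height_mem_heightGroup k),
      fun e => h (e ▸ neg_mem (B.height_mem_heightGroup k))⟩
  exact B.isTranslationAt_crossMap (hG _).2 (hG _).2 (hG _).1

theorem isTranslationAt_crossInvMap_of_notMem {θ : ℝ} {b : ℤ × ℝ}
    (h : (B.crossInvMap θ b).2 ∉ B.heightGroup) (h' : b.2 ∉ B.heightGroup) :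
    B.IsTranslationAt (B.crossInvMap θ) b :=
  B.isTranslationAt_crossInvMap (fun e => h (e ▸ neg_mem (B.height_mem_heightGroup _)))
    (fun e => h' (e ▸ neg_mem (B.height_mem_heightGroup _)))
    (fun e => h' (e ▸ B.height_mem_heightGroup _))

/-- The points of the open fibers over `[-N, N]` at which `f` is not a translation. -/
def singularSet (f : ℤ × ℝ → ℤ × ℝ) (N : ℤ) : Set (ℤ × ℝ) :=
  {b | b ∈ B.openFibers ∧ |b.1| ≤ N ∧ ¬ B.IsTranslationAt f b}

/-- The image of a singular point has one of finitely many abscissas and ordinates, and the crossing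
map is injective on the fibers. -/
theorem finite_singularSet_crossMap (θ : ℝ) (N : ℤ) :
    (B.singularSet (B.crossMap θ) N).Finite := by
  refine Finite.of_finite_image (f := B.crossMap θ) (Finite.subset
    (s := ⋃ k ∈ Icc (-N) N, ({k + 1, -(k + 1)} : Set ℤ) ×ˢ
      ({-B.height k, -B.height (k + 1), B.height (k + 1)} : Set ℝ))
    ((finite_Icc _ _).biUnion fun k _ => (toFinite _).prod (toFinite _)) ?_) ?_
  · rintro _ ⟨b, ⟨-, hN, ht⟩, rfl⟩
    refine mem_iUnion₂.mpr ⟨b.1, abs_le.mp hN, ?_, ?_⟩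
    · simp only [crossMap]
      split_ifs <;> simp
    · by_contra hc
      simp only [mem_insert_iff, mem_singleton_iff, not_or] at hc
      exact ht (B.isTranslationAt_crossMap hc.1 hc.2.1 hc.2.2)
  · intro b hb b' hb' e
    rw [← B.crossInvMap_crossMap θ (mem_fiber_of_mem_openFibers hb.1), e,
      B.crossInvMap_crossMap θ (mem_fiber_of_mem_openFibers hb'.1)]

/-- A backward singularity at abscissa `k` is an end point of the fiber to its left or the image of
the bottom end of a fiber that can lead to `k`; these fibers are `k - 1` and, through the wall, `-k
- 1`. -/
theorem finite_singularSet_crossInvMap (θ : ℝ) (N : ℤ) :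
    (B.singularSet (B.crossInvMap θ) N).Finite := by
  have h : (⋃ k ∈ Icc (-N) N, ({(k, -B.height (k - 1)), (k, B.height (k - 1)),
      B.crossMap θ (k - 1, -B.height (k - 1)),
      B.crossMap θ (-k - 1, -B.height (-k - 1))} : Set (ℤ × ℝ))).Finite :=
    (finite_Icc _ _).biUnion fun k _ => toFinite _
  refine h.subset ?_
  rintro ⟨k, y⟩ ⟨ho, hN, ht⟩
  refine mem_iUnion₂.mpr ⟨k, abs_le.mp hN, ?_⟩
  by_contra hc
  simp only [mem_insert_iff, mem_singleton_iff, not_or] at hc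
  obtain ⟨c1, c2, c3, c4⟩ := hc
  refine ht (B.isTranslationAt_crossInvMap (fun e => ?_) (fun e => c1 ?_) fun e => c2 ?_)
  · have e1 := B.crossMap_crossInvMap θ (mem_fiber_of_mem_openFibers ho)
    have e2 : B.crossInvMap θ (k, y) =
      (B.backColumn k y, -B.height (B.backColumn k y)) := Prod.ext rfl e
    rw [e2] at e1
    by_cases hy : y ∈ B.fiber (k - 1)
    · rw [backColumn, if_pos hy] at e1
      exact c3 e1.symm
    · rw [backColumn, if_neg hy] at e1
      exact c4 e1.symm
  · exact Prod.ext rfl e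
  · exact Prod.ext rfl e

/-! ### Transport of gaps along regular orbits. -/

section Gaps

variable {B} in
theorem IsTranslationAt.continuousAt {f : ℤ × ℝ → ℤ × ℝ} {b : ℤ × ℝ}
    (h : B.IsTranslationAt f b) : ContinuousAt f b := by
  obtain ⟨j, c, h⟩ := h
  have h1 : ∀ᶠ b' in 𝓝 b, f b' = (j, b'.2 + c) := by
    rw [← Prod.mk.eta (p := b), nhds_prod_eq, nhds_discrete, Filter.pure_prod, eventually_map]
    exact h.mono fun y hy => hy.1
  exact (continuousAt_const.prodMk (continuousAt_snd.add continuousAt_const)).congr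
    (h1.mono fun _ h => h.symm)

variable {B} in
theorem IsTranslationAt.apply_mem {f : ℤ × ℝ → ℤ × ℝ} {b : ℤ × ℝ}
    (h : B.IsTranslationAt f b) : f b ∈ B.openFibers := by
  obtain ⟨j, c, h⟩ := h
  obtain ⟨h1, h2⟩ := h.self_of_nhds
  exact h1.symm ▸ h2

variable {B} in
theorem IsTranslationAt.leftInverse {f g : ℤ × ℝ → ℤ × ℝ} {b : ℤ × ℝ}
    (h : B.IsTranslationAt f b) (hb : b ∈ B.openFibers)
    (hg : ∀ b : ℤ × ℝ, b.2 ∈ B.fiber b.1 → g (f b) = b) : B.IsTranslationAt g (f b) := by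
  obtain ⟨j, c, h⟩ := h
  rw [← Prod.mk.eta (p := b), h.self_of_nhds.1]
  refine B.isTranslationAt_of_eventually b.1 (-c) ?_ (by simpa using hb)
  have hc : Tendsto (fun y : ℝ => y - c) (𝓝 (b.2 + c)) (𝓝 b.2) := by
    have : Tendsto (fun y : ℝ => y - c) (𝓝 (b.2 + c)) (𝓝 (b.2 + c - c)) :=
      (continuous_id.sub continuous_const).tendsto _
    rwa [add_sub_cancel_right] at this
  filter_upwards [hc.eventually h, hc.eventually (B.eventually_mem_openFibers hb)] with y h1 h2
  rw [sub_add_cancel] at h1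
  rw [← h1.1, hg _ (mem_fiber_of_mem_openFibers h2), sub_eq_add_neg]

/-- A map that is locally a translation along an interval is a translation there. -/
theorem exists_translation_of_forall {f : ℤ × ℝ → ℤ × ℝ} {k : ℤ} {y s ε : ℝ}
    (h : ∀ t ∈ Ico 0 ε, B.IsTranslationAt f (k, y + s * t)) :
    ∃ (j : ℤ) (c : ℝ), ∀ t ∈ Ico 0 ε,
      f (k, y + s * t) = (j, y + s * t + c) ∧ (j, y + s * t + c) ∈ B.openFibers := by
  rcases le_or_gt ε 0 with hε | hε
  · exact ⟨0, 0, fun t ht => absurd (ht.1.trans_lt ht.2) hε.not_gt⟩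
  -- Target column and displacement together are locally constant, hence constant on the connected
  -- interval.
  let φ : Ico 0 ε → ℤ × ℝ := fun t =>
    ((f (k, y + s * t)).1, (f (k, y + s * t)).2 - (y + s * t))
  have hφ : IsLocallyConstant φ := by
    rw [IsLocallyConstant.iff_eventually_eq]
    intro t
    obtain ⟨j, c, hj⟩ := h t t.2
    have hc : Tendsto (fun t : Ico 0 ε => y + s * (t : ℝ)) (𝓝 t) (𝓝 (y + s * t)) :=
      (continuous_const.add (continuous_const.mul continuous_subtype_val)).tendsto t
    filter_upwards [hc.eventually hj] with t' ht'
    simp only [φ, ht'.1, hj.self_of_nhds.1, add_sub_cancel_left]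
  have : PreconnectedSpace (Ico 0 ε) := isPreconnected_iff_preconnectedSpace.mp isPreconnected_Ico
  let t₀ : Ico 0 ε := ⟨0, le_rfl, hε⟩
  refine ⟨(φ t₀).1, (φ t₀).2, fun t ht => ?_⟩
  have e : φ ⟨t, ht⟩ = φ t₀ := hφ.apply_eq_of_isPreconnected isPreconnected_univ trivial trivial
  have e' : f (k, y + s * t) = ((φ t₀).1, y + s * t + (φ t₀).2) := by
    rw [← e]
    ext1
    · rfl
    · simp only [φ]
      ring
  exact ⟨e', e' ▸ (h t ht).apply_mem⟩

/-- The interval of length `ε` that starts at `b` and points in direction `s` lies in its open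
fiber and off `Ω`. -/
def IsGap (Ω : Set (ℤ × ℝ)) (s : ℝ) (b : ℤ × ℝ) (ε : ℝ) : Prop :=
  ∀ t ∈ Ioo 0 ε, (b.1, b.2 + s * t) ∈ B.openFibers ∧ (b.1, b.2 + s * t) ∉ Ω

variable {f : ℤ × ℝ → ℤ × ℝ} {Ω : Set (ℤ × ℝ)} {s : ℝ}

variable {B} in
theorem IsGap.mono {b : ℤ × ℝ} {ε ε' : ℝ} (h : B.IsGap Ω s b ε) (h' : ε' ≤ ε) :
    B.IsGap Ω s b ε' := fun t ht => h t ⟨ht.1, ht.2.trans_le h'⟩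

/-- A gap along which the map is a translation is mapped to a gap. -/
theorem IsGap.map
    (hinv : ∀ b ∈ B.openFibers, B.IsTranslationAt f b → f b ∈ Ω → b ∈ Ω)
    {b : ℤ × ℝ} {ε : ℝ} (h : B.IsGap Ω s b ε) (hε : 0 < ε) (hb : B.IsTranslationAt f b)
    (hreg : ∀ t ∈ Ioo 0 ε, B.IsTranslationAt f (b.1, b.2 + s * t)) :
    B.IsGap Ω s (f b) ε := by
  obtain ⟨j, c, hj⟩ := B.exists_translation_of_forall (f := f) (k := b.1) (y := b.2) (s := s)
    (ε := ε) fun t ht => by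
      rcases ht.1.eq_or_lt with rfl | h0
      · simpa using hb
      · exact hreg t ⟨h0, ht.2⟩
  have h0 := (hj 0 ⟨le_rfl, hε⟩).1
  simp only [mul_zero, add_zero, Prod.mk.eta] at h0
  intro t ht
  obtain ⟨h1, h2⟩ := hj t (Ioo_subset_Ico_self ht)
  rw [add_right_comm] at h1 h2
  rw [h0]
  refine ⟨h2, fun hm => (h t ht).2 (hinv _ (h t ht).1 (hreg t ht) ?_)⟩
  rwa [h1]

/-- Being a translation is an open condition along the fiber, so a short enough initial piece of the
gap is carried along intact. -/
theorem exists_isGap_map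
    (hinv : ∀ b ∈ B.openFibers, B.IsTranslationAt f b → f b ∈ Ω → b ∈ Ω)
    {b : ℤ × ℝ} {ε : ℝ} (h : B.IsGap Ω s b ε) (hε : 0 < ε) (hb : B.IsTranslationAt f b) :
    ∃ ε' > 0, B.IsGap Ω s (f b) ε' := by
  have hev : ∀ᶠ t in 𝓝 (0 : ℝ), B.IsTranslationAt f (b.1, b.2 + s * t) := by
    obtain ⟨j, c, hj⟩ := hb
    have hc : Tendsto (fun t : ℝ => b.2 + s * t) (𝓝 0) (𝓝 b.2) := by
      have : Tendsto (fun t : ℝ => b.2 + s * t) (𝓝 0) (𝓝 (b.2 + s * 0)) :=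
        (continuous_const.add (continuous_const.mul continuous_id)).tendsto 0
      simpa using this
    exact (hc.eventually hj.eventually_nhds).mono fun t ht => ⟨j, c, ht⟩
  obtain ⟨δ, hδ, hball⟩ := Metric.eventually_nhds_iff.mp hev
  refine ⟨min ε δ, lt_min hε hδ, (h.mono (min_le_left _ _)).map B hinv (lt_min hε hδ) hb ?_⟩
  intro t ht
  refine hball ?_
  rw [Real.dist_eq, sub_zero, abs_of_pos ht.1]
  exact ht.2.trans_le (min_le_right _ _)

/-- An infinite orbit in `Ω` of points at which the map is a translation cannot consist of end
points of gaps. -/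
theorem not_isGap_of_orbit {N : ℤ} (hΩ : Ω ⊆ B.openFibers) (hN : ∀ b ∈ Ω, |b.1| ≤ N)
    (hinv : ∀ b ∈ B.openFibers, B.IsTranslationAt f b → f b ∈ Ω → b ∈ Ω)
    (hfin : (B.singularSet f N).Finite) {l : ℕ → ℤ × ℝ} (hl : ∀ n, l (n + 1) = f (l n))
    (hinj : Function.Injective l) (hlΩ : ∀ n, l n ∈ Ω) (hreg : ∀ n, B.IsTranslationAt f (l n))
    (hs : s = 1 ∨ s = -1) {ε : ℝ} (hε : 0 < ε) : ¬ B.IsGap Ω s (l 0) ε := by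
  intro hgap
  have hss : s * s = 1 := by rcases hs with rfl | rfl <;> norm_num
  have hex : ∀ n, ∃ ε > 0, B.IsGap Ω s (l n) ε := by
    intro n
    induction n with
    | zero => exact ⟨ε, hε, hgap⟩
    | succ n ih =>
      obtain ⟨ε, hε, h⟩ := ih
      rw [hl]
      exact B.exists_isGap_map hinv h hε (hreg n)
  -- if two points of the orbit are in the same fiber, one lies in direction `s` from the other
  have hsep : ∀ m n, (l m).1 = (l n).1 → m ≠ n →
      (∀ t > 0, l m = ((l n).1, (l n).2 + s * t) → False) →
      ∃ t > 0, l n = ((l m).1, (l m).2 + s * t) := by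
    intro m n h1 hmn h2
    rcases lt_trichotomy (s * ((l m).2 - (l n).2)) 0 with h | h | h
    · refine ⟨s * ((l n).2 - (l m).2), by linarith, Prod.ext h1.symm ?_⟩
      simp only [← mul_assoc, hss]
      ring
    · refine absurd (hinj (Prod.ext h1 ?_)) hmn
      rcases hs with rfl | rfl <;> linarith
    · refine (h2 _ h (Prod.ext h1 ?_)).elim
      simp only [← mul_assoc, hss]
      ring
  -- A point `b` can be seen across a gap from only one orbit point: of two such orbit points on the
  -- same side of `b`, the nearer would be a point of `Ω` inside the gap of the farther.
  have hadj : ∀ b : ℤ × ℝ, {n | ∃ t > 0, b = ((l n).1, (l n).2 + s * t) ∧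
      B.IsGap Ω s (l n) t}.Subsingleton := by
    rintro b n ⟨t, ht, hb, hg⟩ n' ⟨t', ht', hb', hg'⟩
    by_contra hne
    obtain ⟨e1, e2⟩ : (l n').1 = (l n).1 ∧ (l n').2 + s * t' = (l n).2 + s * t :=
      Prod.ext_iff.mp (hb'.symm.trans hb)
    have key : ∀ m m' : ℕ, ∀ r r' : ℝ, 0 < r' → (l m').2 + s * r' = (l m).2 + s * r →
        B.IsGap Ω s (l m) r → ∀ q > 0, l m' = ((l m).1, (l m).2 + s * q) → False := by
      intro m m' r r' hr' he hgm q hq hq'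
      have e3 : (l m').2 = (l m).2 + s * q := by rw [hq']
      have e4 : s * (q + r') = s * r := by linarith
      have e5 : q + r' = r := by
        have := congrArg (s * ·) e4
        simpa only [← mul_assoc, hss, one_mul] using this
      exact (hgm q ⟨hq, by linarith⟩).2 (hq' ▸ hlΩ m')
    obtain ⟨q, hq, hq'⟩ := hsep n' n e1 (Ne.symm hne) (key n n' t t' ht' e2 hg)
    exact key n' n t' t ht e2.symm hg' q hq hq'
  have hbad : (⋃ b ∈ B.singularSet f N, {n | ∃ t > 0, b = ((l n).1, (l n).2 + s * t) ∧
      B.IsGap Ω s (l n) t}).Finite := hfin.biUnion fun b _ => (hadj b).finite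
  obtain ⟨n₀, hn₀⟩ := hbad.bddAbove
  obtain ⟨ε, hε, hgap⟩ := hex (n₀ + 1)
  -- Beyond `n₀` no singularity lies in the gap, so its length is no longer reduced.
  have hall : ∀ n, n₀ + 1 ≤ n → B.IsGap Ω s (l n) ε := by
    intro n hn
    induction n, hn using Nat.le_induction with
    | base => exact hgap
    | succ n hn ih =>
      rw [hl]
      refine ih.map B hinv hε (hreg n) fun t ht => ?_
      by_contra hsing
      have : n ≤ n₀ := hn₀ (mem_iUnion₂.mpr ⟨_, ⟨(ih t ht).1, hN (l n) (hlΩ n), hsing⟩, t, ht.1, rfl,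
        ih.mono ht.2.le⟩)
      omega
  -- Pigeonhole: two orbit points in one cell of size `ε` are so close that one lies in the gap of
  -- the other.
  let cell : ℕ → ℤ × ℤ := fun n => ((l n).1, ⌊(l n).2 / ε⌋)
  have hmaps : MapsTo cell (Ici (n₀ + 1)) (Icc (-N) N ×ˢ Icc ⌊-1 / ε⌋ ⌊1 / ε⌋) := by
    intro n _
    have h1 : -B.height (l n).1 < (l n).2 ∧ (l n).2 < B.height (l n).1 :=
      abs_lt.mp (hΩ (hlΩ n))
    have h2 := B.height_le_one (l n).1
    refine ⟨abs_le.mp (hN _ (hlΩ n)), Int.floor_le_floor ?_, Int.floor_le_floor ?_⟩ <;>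
    · gcongr
      linarith
  obtain ⟨m, hm, n, hn, hmn, hcell⟩ := (Ici_infinite (n₀ + 1)).exists_ne_map_eq_of_mapsTo hmaps
    ((finite_Icc _ _).prod (finite_Icc _ _))
  obtain ⟨e1, e2⟩ : (l m).1 = (l n).1 ∧ ⌊(l m).2 / ε⌋ = ⌊(l n).2 / ε⌋ := Prod.ext_iff.mp hcell
  replace e2 := Int.abs_sub_lt_one_of_floor_eq_floor e2
  rw [← sub_div, abs_div, abs_of_pos hε, div_lt_one hε] at e2
  have key : ∀ m n : ℕ, |(l m).2 - (l n).2| < ε → B.IsGap Ω s (l n) ε →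
      ∀ q > 0, l m = ((l n).1, (l n).2 + s * q) → False := by
    intro m n hlt hg q hq he
    refine (hg q ⟨hq, ?_⟩).2 (he ▸ hlΩ m)
    rw [he] at hlt
    simp only [add_sub_cancel_left, abs_mul, abs_of_pos hq] at hlt
    rcases hs with rfl | rfl <;> simpa using hlt
  obtain ⟨q, hq, hq'⟩ := hsep m n e1 hmn (key m n e2 (hall n hn))
  exact key n m (by rwa [abs_sub_comm]) (hall m hm) q hq hq'

end Gaps

/-! ### Accumulation sets of orbits in finitely many columns. -/

section Accumulation

variable {F : Filter ℤ} {u : ℤ → ℤ × ℝ} {f : ℤ × ℝ → ℤ × ℝ} {θ : ℝ} {N : ℤ}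

/-- The accumulation points of `u` along `F` that lie in the open fibers. -/
def clusterSet (F : Filter ℤ) (u : ℤ → ℤ × ℝ) : Set (ℤ × ℝ) :=
  {b | b ∈ B.openFibers ∧ MapClusterPt b F u}

variable {B} in
theorem apply_mem_clusterSet {e : ℤ} (he : Tendsto (· + e) F F)
    (hu : ∀ i, u (i + e) = f (u i)) {b : ℤ × ℝ} (hb : b ∈ B.clusterSet F u)
    (hreg : B.IsTranslationAt f b) : f b ∈ B.clusterSet F u := by
  refine ⟨hreg.apply_mem, MapClusterPt.of_comp he ?_⟩
  have := hb.2.continuousAt_comp hreg.continuousAt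
  rwa [show f ∘ u = u ∘ (· + e) from funext fun i => (hu i).symm] at this

variable {B} in
theorem mem_clusterSet_of_apply_mem {g : ℤ × ℝ → ℤ × ℝ} {e : ℤ} (he : Tendsto (· + e) F F)
    (hu : ∀ i, u (i + e) = g (u i)) (hg : ∀ b : ℤ × ℝ, b.2 ∈ B.fiber b.1 → g (f b) = b)
    {b : ℤ × ℝ} (hb : b ∈ B.openFibers) (hreg : B.IsTranslationAt f b)
    (hfb : f b ∈ B.clusterSet F u) : b ∈ B.clusterSet F u := by
  have := apply_mem_clusterSet he hu hfb (hreg.leftInverse hb hg)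
  rwa [hg b (mem_fiber_of_mem_openFibers hb)] at this

theorem isClosed_mapClusterPt (k : ℤ) : IsClosed {y : ℝ | MapClusterPt (k, y) F u} :=
  (isClosed_setOfPred_clusterPt (f := map u F)).preimage (Continuous.prodMk_right k)

variable {B} in
theorem abs_fst_le_of_mapClusterPt (hN : ∀ᶠ i in F, |(u i).1| ≤ N) {b : ℤ × ℝ}
    (hb : MapClusterPt b F u) : |b.1| ≤ N :=
  IsClosed.mem_of_mapClusterPt (s := {b : ℤ × ℝ | |b.1| ≤ N})
    ((isClosed_discrete {k : ℤ | |k| ≤ N}).preimage continuous_fst) hb hN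

/-- If no point of the accumulation set is an end point of a gap, then the accumulation set
meets a given open fiber either nowhere or everywhere. -/
theorem clusterSet_full_of_not_isGap
    (h : ∀ b ∈ B.clusterSet F u, ∀ s : ℝ, s = 1 ∨ s = -1 → ∀ ε > 0,
      ¬ B.IsGap (B.clusterSet F u) s b ε)
    {b : ℤ × ℝ} (hb : b ∈ B.clusterSet F u) {y : ℝ} (hy : (b.1, y) ∈ B.openFibers) :
    (b.1, y) ∈ B.clusterSet F u := by
  obtain ⟨k, a⟩ := b
  simp only at hy ⊢
  by_contra hc
  have hcl := isClosed_mapClusterPt (F := F) (u := u) k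
  have hya : ¬ MapClusterPt (k, y) F u := fun h => hc ⟨hy, h⟩
  have hbo : -B.height k < a ∧ a < B.height k := abs_lt.mp hb.1
  have hyo : -B.height k < y ∧ y < B.height k := abs_lt.mp hy
  have hopen : ∀ {z}, -B.height k < z → z < B.height k → (k, z) ∈ B.openFibers :=
    fun h h' => abs_lt.mpr ⟨h, h'⟩
  rcases le_or_gt a y with hay | hay
  -- The last accumulation point `l` before `y` begins a gap of length `y - l`.
  · obtain ⟨l, ⟨hl, hl'⟩, hmax⟩ := (isCompact_Icc.inter_left hcl).exists_isGreatest
      ⟨a, hb.2, le_rfl, hay⟩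
    have hly : l < y := lt_of_le_of_ne hl'.2 fun e => hya (e ▸ hl)
    refine h (k, l) ⟨hopen (hbo.1.trans_le hl'.1) (hl'.2.trans_lt hyo.2), hl⟩ 1 (Or.inl rfl)
      (y - l) (sub_pos.mpr hly) fun t ht => ?_
    simp only [one_mul]
    refine ⟨hopen (by linarith [ht.1, hl'.1]) (by linarith [ht.2]), fun hm => ?_⟩
    have := hmax ⟨hm.2, by linarith [ht.1, hl'.1], by linarith [ht.2]⟩
    linarith [ht.1]
  · obtain ⟨l, ⟨hl, hl'⟩, hmin⟩ := (isCompact_Icc.inter_left hcl).exists_isLeast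
      ⟨a, hb.2, hay.le, le_rfl⟩
    have hly : y < l := lt_of_le_of_ne hl'.1 fun e => hya (e ▸ hl)
    refine h (k, l) ⟨hopen (hyo.1.trans_le hl'.1) (hl'.2.trans_lt hbo.2), hl⟩ (-1) (Or.inr rfl)
      (l - y) (sub_pos.mpr hly) fun t ht => ?_
    simp only [neg_one_mul]
    refine ⟨hopen (by linarith [ht.2]) (by linarith [ht.1, hl'.2]), fun hm => ?_⟩
    have := hmin ⟨hm.2, by linarith [ht.2], by linarith [ht.1, hl'.2]⟩
    linarith [ht.1]

/-! ### Free directions. -/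

/-- The slope of the direction `θ` has infinite order modulo the heights of the billiard. -/
def IsFreeDirection (θ : ℝ) : Prop := ∀ m : ℤ, m ≠ 0 → m * Real.tan θ ∉ B.heightGroup

variable {B}

theorem IsFreeDirection.eq_of_mem (hθ : B.IsFreeDirection θ) (c : B.LeftEdge) {i j : ℤ}
    (h : ((B.cross θ ^ i) c).1.2 - ((B.cross θ ^ j) c).1.2 ∈ B.heightGroup) : i = j := by
  by_contra hij
  refine hθ (i - j) (sub_ne_zero.mpr hij) ?_
  have := sub_mem h (sub_mem (B.cross_zpow_sub_mem θ i c) (B.cross_zpow_sub_mem θ j c))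
  push_cast
  convert this using 1
  ring

theorem IsFreeDirection.not_isGap_clusterSet (hθ : B.IsFreeDirection θ)
    (h1 : Tendsto (· + 1) F F) (h2 : Tendsto (· + -1) F F) (hN : ∀ᶠ i in F, |(u i).1| ≤ N)
    (hu : ∀ i, u (i + 1) = B.crossMap θ (u i)) (hu' : ∀ i, u (i + -1) = B.crossInvMap θ (u i))
    {b : ℤ × ℝ} (hb : b ∈ B.clusterSet F u) {s : ℝ} (hs : s = 1 ∨ s = -1) {ε : ℝ} (hε : 0 < ε) :
    ¬ B.IsGap (B.clusterSet F u) s b ε := by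
  let c : B.LeftEdge := ⟨b, mem_fiber_of_mem_openFibers hb.1⟩
  have hΩ : B.clusterSet F u ⊆ B.openFibers := fun _ h => h.1
  have hN' : ∀ b ∈ B.clusterSet F u, |b.1| ≤ N := fun _ h => abs_fst_le_of_mapClusterPt hN h.2
  -- Forward regularity involves only the ordinates of images, so time `0` may be excluded. If the
  -- forward half fails at some `i₀ ≥ 1`, every time `i ≤ 0` is safe, as the backward argument
  -- needs.
  by_cases hA : ∀ i : ℤ, 1 ≤ i → ((B.cross θ ^ i) c).1.2 ∉ B.heightGroup
  · have hl : ∀ n : ℕ, ((B.cross θ ^ ((n + 1 : ℕ) : ℤ)) c).1 =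
        B.crossMap θ ((B.cross θ ^ (n : ℤ)) c).1 := by
      intro n
      push_cast
      exact B.coe_cross_zpow_add_one θ n c
    have hreg : ∀ n : ℕ, B.IsTranslationAt (B.crossMap θ) ((B.cross θ ^ (n : ℤ)) c).1 := by
      intro n
      refine B.isTranslationAt_crossMap_of_notMem ?_
      rw [← hl]
      exact hA _ (by push_cast; omega)
    refine B.not_isGap_of_orbit hΩ hN'
      (fun b hb hr => mem_clusterSet_of_apply_mem h2 hu' (fun b => B.crossInvMap_crossMap θ) hb hr)
      (B.finite_singularSet_crossMap θ N) (l := fun n : ℕ => ((B.cross θ ^ (n : ℤ)) c).1)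
      hl ?_ ?_ hreg hs hε
    · intro m n e
      have := hθ.eq_of_mem c (i := m) (j := n) (by simp only at e; rw [e, sub_self]; exact zero_mem _)
      exact_mod_cast this
    · intro n
      induction n with
      | zero => exact hb
      | succ n ih =>
        simp only [hl]
        exact apply_mem_clusterSet h1 hu ih (hreg n)
  · push Not at hA
    obtain ⟨i₀, hi₀, hmem⟩ := hA
    have hA : ∀ i : ℤ, i ≤ 0 → ((B.cross θ ^ i) c).1.2 ∉ B.heightGroup := by
      intro i hi hm
      have := hθ.eq_of_mem c (sub_mem hm hmem)
      omega
    have hl : ∀ n : ℕ, ((B.cross θ ^ (-((n + 1 : ℕ) : ℤ))) c).1 =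
        B.crossInvMap θ ((B.cross θ ^ (-(n : ℤ))) c).1 := by
      intro n
      rw [← coe_cross_zpow_sub_one]
      push_cast
      rw [neg_add, sub_eq_add_neg]
    have hreg : ∀ n : ℕ, B.IsTranslationAt (B.crossInvMap θ) ((B.cross θ ^ (-(n : ℤ))) c).1 := by
      intro n
      refine B.isTranslationAt_crossInvMap_of_notMem ?_ (hA _ (by omega))
      rw [← hl]
      exact hA _ (by push_cast; omega)
    refine B.not_isGap_of_orbit hΩ hN'
      (fun b hb hr => mem_clusterSet_of_apply_mem h1 hu (fun b => B.crossMap_crossInvMap θ) hb hr)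
      (B.finite_singularSet_crossInvMap θ N) (l := fun n : ℕ => ((B.cross θ ^ (-(n : ℤ))) c).1)
      hl ?_ ?_ hreg hs hε
    · intro m n e
      have := hθ.eq_of_mem c (i := -m) (j := -n)
        (by simp only at e; rw [e, sub_self]; exact zero_mem _)
      omega
    · intro n
      induction n with
      | zero => exact hb
      | succ n ih =>
        simp only [hl]
        exact apply_mem_clusterSet h2 hu' ih (hreg n)

/-- Every open fiber is reached from the open fiber on its left at generic points. -/
theorem exists_crossMap_eq (θ : ℝ) (k : ℤ) : ∃ b ∈ B.openFibers, b.1 = k ∧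
    (B.crossMap θ b).1 = k + 1 ∧ B.IsTranslationAt (B.crossMap θ) b := by
  have hG : ((B.heightGroup : Set ℝ) ∪ (· + Real.tan θ) '' (B.heightGroup : Set ℝ)).Countable :=
    B.countable_heightGroup.union (B.countable_heightGroup.image _)
  -- A target below both heights is reached through the opening. Avoiding the group makes the
  -- crossing regular; avoiding its translate by `tan θ` keeps the preimage off the bottom end.
  obtain ⟨c, hc, hc0, hc1⟩ := (hG.dense_compl ℝ).exists_between
    (lt_min (B.height_pos k) (B.height_pos (k + 1)))
  rw [mem_compl_iff, mem_union, not_or] at hc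
  obtain ⟨hcG, hcG'⟩ := hc
  have hck : c ∈ B.fiber k :=
    ⟨by linarith [B.height_pos k], hc1.trans_le (min_le_left _ _)⟩
  have hck' : c ∈ B.fiber (k + 1) :=
    ⟨by linarith [B.height_pos (k + 1)], hc1.trans_le (min_le_right _ _)⟩
  have hback : B.backColumn (k + 1) c = k := by
    rw [backColumn, if_pos (by rwa [add_sub_cancel_right]), add_sub_cancel_right]
  have he : B.crossInvMap θ (k + 1, c) = (k, B.wrap k (c - Real.tan θ)) := by
    simp only [crossInvMap, hback]
  have hf : B.crossMap θ (k, B.wrap k (c - Real.tan θ)) = (k + 1, c) := by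
    rw [← he]
    exact B.crossMap_crossInvMap θ hck'
  refine ⟨(k, B.wrap k (c - Real.tan θ)), B.mem_openFibers_of_mem_fiber (B.wrap_mem k _) ?_, rfl,
    by rw [hf], B.isTranslationAt_crossMap_of_notMem (by rwa [hf])⟩
  intro hw
  have := B.wrap_sub_mem k (c - Real.tan θ)
  rw [hw] at this
  refine hcG' ⟨c - Real.tan θ, ?_, by simp⟩
  have h3 := sub_mem (neg_mem (B.height_mem_heightGroup k)) this
  rwa [sub_sub_cancel] at h3

/-- A fiber that is met is full, so it contains a regular point that crosses to the right. By
induction all columns to the right are met, beyond the bound `N`. -/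
theorem clusterSet_eq_empty (h1 : Tendsto (· + 1) F F) (hN : ∀ᶠ i in F, |(u i).1| ≤ N)
    (hu : ∀ i, u (i + 1) = B.crossMap θ (u i))
    (hgap : ∀ b ∈ B.clusterSet F u, ∀ s : ℝ, s = 1 ∨ s = -1 → ∀ ε > 0,
      ¬ B.IsGap (B.clusterSet F u) s b ε) : B.clusterSet F u = ∅ := by
  refine eq_empty_of_forall_notMem fun b hb => ?_
  have hall : ∀ k, b.1 ≤ k → ∃ b' ∈ B.clusterSet F u, b'.1 = k := by
    intro k hk
    induction k, hk using Int.leInduction with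
    | base => exact ⟨b, hb, rfl⟩
    | succ k hk ih =>
      obtain ⟨b', hb', rfl⟩ := ih
      obtain ⟨d, hd, hdk, hdk', hreg⟩ := exists_crossMap_eq (B := B) θ b'.1
      have hd' : d ∈ B.clusterSet F u := by
        rw [← Prod.mk.eta (p := d), hdk] at hd ⊢
        exact B.clusterSet_full_of_not_isGap hgap hb' hd
      exact ⟨_, apply_mem_clusterSet h1 hu hd' hreg, hdk'⟩
  obtain ⟨b', hb', e⟩ := hall (max b.1 (N + 1)) (le_max_left _ _)
  have h := (le_abs_self _).trans (abs_fst_le_of_mapClusterPt hN hb'.2)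
  have := le_max_right b.1 (N + 1)
  omega

theorem mem_heightGroup_of_notMem_openFibers {b : ℤ × ℝ} (h : |b.2| ≤ B.height b.1)
    (h' : b ∉ B.openFibers) : b.2 ∈ B.heightGroup := by
  have e : |b.2| = B.height b.1 := le_antisymm h (not_lt.mp h')
  have hm := B.height_mem_heightGroup b.1
  rcases abs_choice b.2 with h0 | h0 <;> rw [← e, h0] at hm
  · exact hm
  · exact neg_mem_iff.mp hm

theorem isClosed_zmultiples (a : ℝ) : IsClosed (AddSubgroup.zmultiples a : Set ℝ) :=
  AddSubgroup.isClosed_of_discrete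

theorem abs_snd_le_of_mapClusterPt (hmem : ∀ i, (u i).2 ∈ B.fiber (u i).1) {b : ℤ × ℝ}
    (hb : MapClusterPt b F u) : |b.2| ≤ B.height b.1 := by
  refine IsClosed.mem_of_mapClusterPt (s := {b : ℤ × ℝ | |b.2| ≤ B.height b.1})
    (isClosed_le (by fun_prop) ((continuous_of_discreteTopology (f := B.height)).comp
      continuous_fst)) hb (.of_forall fun i => ?_)
  exact abs_le.mpr ⟨(hmem i).1, (hmem i).2.le⟩

/-- Accumulation points of an orbit that stays in finitely many columns exist in the open
fibers. -/
theorem IsFreeDirection.clusterSet_nonempty [NeBot F] (hθ : B.IsFreeDirection θ)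
    (h1 : Tendsto (· + 1) F F) (hN : ∀ᶠ i in F, |(u i).1| ≤ N)
    (hmem : ∀ i, (u i).2 ∈ B.fiber (u i).1)
    (hu : ∀ i, u (i + 1) = B.crossMap θ (u i)) : (B.clusterSet F u).Nonempty := by
  by_contra hempty
  rw [not_nonempty_iff_eq_empty] at hempty
  let K : Set (ℤ × ℝ) := Icc (-N) N ×ˢ Icc (-1) 1
  have hK : IsCompact K := (finite_Icc _ _).isCompact.prod isCompact_Icc
  have hKu : ∀ i, |(u i).1| ≤ N → u i ∈ K := by
    intro i hi
    have := B.height_le_one (u i).1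
    exact ⟨abs_le.mp hi, by linarith [(hmem i).1], by linarith [(hmem i).2]⟩
  -- Compactness is applied to pairs of consecutive points, since the crossing map need not be
  -- continuous at the limit `b`.
  obtain ⟨⟨b, b'⟩, -, hbb⟩ := (hK.prod hK).exists_mapClusterPt (f := F)
    (u := fun i => (u i, u (i + 1)))
    (tendsto_principal.mpr <| hN.and (h1.eventually hN) |>.mono fun i hi =>
      ⟨hKu _ hi.1, hKu _ hi.2⟩)
  have hb : MapClusterPt b F u := hbb.continuousAt_comp continuousAt_fst
  have hb' : MapClusterPt b' F u :=
    MapClusterPt.of_comp h1 (hbb.continuousAt_comp continuousAt_snd)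
  have key : ∀ b, MapClusterPt b F u → b.2 ∈ B.heightGroup := fun b hb =>
    mem_heightGroup_of_notMem_openFibers (abs_snd_le_of_mapClusterPt hmem hb) fun ho =>
      (hempty ▸ (⟨ho, hb⟩ : b ∈ B.clusterSet F u) : b ∈ (∅ : Set (ℤ × ℝ)))
  -- The group of heights need not be closed; this finite union of discrete subgroups is, and it
  -- contains the wrapping shifts in the columns concerned.
  let D : Set ℝ := ⋃ k ∈ Icc (-N) N, (AddSubgroup.zmultiples (2 * B.height k) : Set ℝ)
  have hD : IsClosed D := (finite_Icc _ _).isClosed_biUnion fun k _ => isClosed_zmultiples _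
  have hmemD : b'.2 - (b.2 + Real.tan θ) ∈ D := by
    refine IsClosed.mem_of_mapClusterPt (s := (fun q : (ℤ × ℝ) × (ℤ × ℝ) =>
      q.2.2 - (q.1.2 + Real.tan θ)) ⁻¹' D) (hD.preimage (by fun_prop)) hbb
      (hN.mono fun i hi => ?_)
    refine mem_iUnion₂.mpr ⟨(u i).1, abs_le.mp hi, ?_⟩
    simp only [hu]
    exact B.wrap_sub_mem_zmultiples _ _
  obtain ⟨k, -, hk⟩ := mem_iUnion₂.mp hmemD
  have := sub_mem (sub_mem (key b' hb') (B.zmultiples_le_heightGroup k hk)) (key b hb)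
  refine hθ 1 one_ne_zero ?_
  convert this using 1
  push_cast
  ring

/-- In a free direction no orbit stays in finitely many columns. -/
theorem IsFreeDirection.not_eventually_abs_le [NeBot F] (hθ : B.IsFreeDirection θ)
    (h1 : Tendsto (· + 1) F F) (h2 : Tendsto (· + -1) F F) (c : B.LeftEdge) (N : ℤ) :
    ¬ ∀ᶠ i in F, |((B.cross θ ^ i) c).1.1| ≤ N := by
  intro hN
  let u : ℤ → ℤ × ℝ := fun i => ((B.cross θ ^ i) c).1
  have hu : ∀ i, u (i + 1) = B.crossMap θ (u i) := fun i => B.coe_cross_zpow_add_one θ i c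
  refine (hθ.clusterSet_nonempty (u := u) h1 hN (fun i => ((B.cross θ ^ i) c).2) hu).ne_empty ?_
  exact clusterSet_eq_empty h1 hN hu fun b hb s hs ε hε =>
    hθ.not_isGap_clusterSet h1 h2 hN hu (fun i => B.coe_cross_zpow_sub_one θ i c) hb hs hε

end Accumulation

/-! ### From column crossings to the flow. -/

variable {B} {θ : ℝ}

/-- The point of the left edge of its column from which the trajectory of `z` arrives. -/
def Surface.start (θ : ℝ) (z : B.Surface) : B.LeftEdge :=
  ⟨(⌊z.1.1⌋, B.wrap ⌊z.1.1⌋ (z.1.2 - Int.fract z.1.1 * Real.tan θ)), B.wrap_mem _ _⟩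

theorem coe_flow (θ t : ℝ) (z : B.Surface) {i : ℤ} {r : ℝ} (hr : r ∈ Ico (0 : ℝ) 1)
    (h : Int.fract z.1.1 + t * Real.cos θ = i + r) :
    (B.flow θ t z).1 = ((((B.cross θ ^ i) (z.start θ)).1.1 : ℝ) + r,
      B.wrap ((B.cross θ ^ i) (z.start θ)).1.1
        (((B.cross θ ^ i) (z.start θ)).1.2 + r * Real.tan θ)) := by
  have h1 : ⌊Int.fract z.1.1 + t * Real.cos θ⌋ = i :=
    Int.floor_eq_iff.mpr ⟨by linarith [hr.1], by linarith [hr.2]⟩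
  have h2 : Int.fract (Int.fract z.1.1 + t * Real.cos θ) = r := by
    rw [Int.fract, h1]
    linarith
  simp only [flow, h1, h2]
  rfl

theorem position_flow_fst (hc : Real.cos θ ≠ 0) (z : B.Surface) (i : ℤ) :
    (B.flow θ ((i - Int.fract z.1.1) / Real.cos θ) z).position.1 =
      |(((B.cross θ ^ i) (z.start θ)).1.1 : ℝ)| := by
  rw [Surface.position, coe_flow (i := i) (r := 0) θ _ z ⟨le_rfl, one_pos⟩]
  · simp
  · rw [div_mul_cancel₀ _ hc]
    ring

/-- If the positions at the times when the trajectory meets the edges of the columns are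
bounded along `F`, then so are the columns. -/
theorem exists_eventually_abs_le {F : Filter ℤ} {S : Set (ℝ × ℝ)} (hS : Bornology.IsBounded S)
    (hc : Real.cos θ ≠ 0) (z : B.Surface)
    (h : ∀ᶠ i : ℤ in F, (B.flow θ ((i - Int.fract z.1.1) / Real.cos θ) z).position ∈ S) :
    ∃ N : ℤ, ∀ᶠ i in F, |((B.cross θ ^ i) (z.start θ)).1.1| ≤ N := by
  obtain ⟨R, hR⟩ := hS.exists_norm_le
  refine ⟨⌈R⌉, h.mono fun i hi => ?_⟩
  have h1 := (norm_fst_le _).trans (hR _ hi)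
  rw [position_flow_fst hc, Real.norm_eq_abs, abs_abs] at h1
  exact_mod_cast h1.trans (Int.le_ceil R)

theorem cos_pos_of_mem (hθ : θ ∈ Ioo 0 (Real.pi / 2)) : 0 < Real.cos θ :=
  Real.cos_pos_of_mem_Ioo ⟨by linarith [hθ.1, Real.pi_pos], hθ.2⟩

theorem IsFreeDirection.not_isBounded_forwardSemiOrbit (hθ : B.IsFreeDirection θ)
    (hc : 0 < Real.cos θ) (z : B.Surface) :
    ¬ Bornology.IsBounded (B.forwardSemiOrbit θ z) := by
  intro hS
  obtain ⟨N, hN⟩ := exists_eventually_abs_le (F := atTop) hS hc.ne' z <| by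
    -- The starting point may lie inside its column, so the crossing of index `1` is the first sure
    -- to occur at a nonnegative time.
    filter_upwards [eventually_ge_atTop 1] with i hi
    refine ⟨_, ?_, rfl⟩
    have h1 : (1 : ℝ) ≤ i := by exact_mod_cast hi
    exact div_nonneg (by linarith [Int.fract_lt_one z.1.1]) hc.le
  exact hθ.not_eventually_abs_le (tendsto_atTop_add_const_right _ _ tendsto_id)
    (tendsto_atTop_add_const_right _ _ tendsto_id) _ N hN

theorem IsFreeDirection.not_isBounded_backwardSemiOrbit (hθ : B.IsFreeDirection θ)
    (hc : 0 < Real.cos θ) (z : B.Surface) :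
    ¬ Bornology.IsBounded (B.backwardSemiOrbit θ z) := by
  intro hS
  obtain ⟨N, hN⟩ := exists_eventually_abs_le (F := atBot) hS hc.ne' z <| by
    filter_upwards [eventually_le_atBot 0] with i hi
    refine ⟨_, ?_, rfl⟩
    have h1 : (i : ℝ) ≤ 0 := by exact_mod_cast hi
    exact div_nonpos_of_nonpos_of_nonneg (by linarith [Int.fract_nonneg z.1.1]) hc.le
  exact hθ.not_eventually_abs_le (tendsto_atBot_add_const_right _ _ tendsto_id)
    (tendsto_atBot_add_const_right _ _ tendsto_id) _ N hN

/-- There are no periodic trajectories in a free direction. -/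
theorem IsFreeDirection.not_isPeriodic (hθ : B.IsFreeDirection θ) (hc : 0 < Real.cos θ)
    (z : B.Surface) : ¬ B.IsPeriodic θ z := by
  rintro ⟨T, hT, hz⟩
  set v := Int.fract z.1.1 + T * Real.cos θ with hv
  set c := (B.cross θ ^ ⌊v⌋) (z.start θ) with hcdef
  have h := coe_flow θ T z (i := ⌊v⌋) ⟨Int.fract_nonneg v, Int.fract_lt_one v⟩
    (Int.floor_add_fract v).symm
  rw [hz, ← hcdef] at h
  obtain ⟨hX, hY⟩ : z.1.1 = c.1.1 + Int.fract v ∧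
    z.1.2 = B.wrap c.1.1 (c.1.2 + Int.fract v * Real.tan θ) := Prod.ext_iff.mp h
  have hfract : Int.fract z.1.1 = Int.fract v := by
    rw [hX, Int.fract_intCast_add, Int.fract_fract]
  -- On return the offset within the column is the same, so the horizontal distance travelled is a
  -- whole number of columns.
  have hm : (⌊v⌋ : ℝ) = T * Real.cos θ := by
    have := Int.floor_add_fract v
    rw [← hfract] at this
    linarith
  have hne : ⌊v⌋ ≠ 0 := by
    intro h0
    rw [h0, Int.cast_zero] at hm
    exact (mul_pos hT hc).ne hm
  refine hθ _ hne ?_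
  have g1 := B.wrap_sub_mem c.1.1 (c.1.2 + Int.fract v * Real.tan θ)
  have g2 := B.cross_zpow_sub_mem θ ⌊v⌋ (z.start θ)
  have g3 := B.wrap_sub_mem ⌊z.1.1⌋ (z.1.2 - Int.fract z.1.1 * Real.tan θ)
  have g4 : (z.start θ).1.2 = B.wrap ⌊z.1.1⌋ (z.1.2 - Int.fract z.1.1 * Real.tan θ) := rfl
  rw [← hY] at g1
  rw [← g4, hfract] at g3
  rw [← hcdef] at g2
  convert neg_mem (add_mem (add_mem g1 g2) g3) using 1
  ring

/-- For each `m ≠ 0`, the map `θ ↦ m * Real.tan θ` is injective on the interval, and it sends the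
directions excluded by `m` into a countable group. -/
theorem countable_not_isFreeDirection (B : StepBilliard) :
    {θ | θ ∈ Ioo 0 (Real.pi / 2) ∧ ¬ B.IsFreeDirection θ}.Countable := by
  have h : ∀ m : ℤ, m ≠ 0 →
      {θ | θ ∈ Ioo 0 (Real.pi / 2) ∧ m * Real.tan θ ∈ B.heightGroup}.Countable := by
    intro m hm
    refine MapsTo.countable_of_injOn (f := fun θ => m * Real.tan θ) (fun θ hθ => hθ.2) ?_
      B.countable_heightGroup
    intro θ hθ θ' hθ' e
    have hsub : ∀ {x}, x ∈ Ioo 0 (Real.pi / 2) → x ∈ Ioo (-(Real.pi / 2)) (Real.pi / 2) :=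
      fun hx => ⟨by linarith [hx.1, Real.pi_pos], hx.2⟩
    exact Real.injOn_tan (hsub hθ.1) (hsub hθ'.1)
      (mul_left_cancel₀ (Int.cast_ne_zero.mpr hm) e)
  refine (countable_iUnion fun m : ℤ => countable_iUnion fun hm : m ≠ 0 => h m hm).mono ?_
  rintro θ ⟨hθ, hfree⟩
  simp only [IsFreeDirection, not_forall, not_not] at hfree
  obtain ⟨m, hm, hmem⟩ := hfree
  exact mem_iUnion₂.mpr ⟨m, hm, hθ, hmem⟩

/-! ### The dyadic example of coexistence. -/

theorem crossMap_of_mem {k : ℤ} {y y' : ℝ} (h : B.wrap k (y + Real.tan θ) = y')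
    (hm : y' ∈ B.fiber (k + 1)) : B.crossMap θ (k, y) = (k + 1, y') := by
  subst h
  exact Prod.ext (if_pos hm) rfl

theorem crossMap_of_notMem {k : ℤ} {y y' : ℝ} (h : B.wrap k (y + Real.tan θ) = y')
    (hm : y' ∉ B.fiber (k + 1)) : B.crossMap θ (k, y) = (-(k + 1), y') := by
  subst h
  exact Prod.ext (if_neg hm) rfl

/-- The step billiard with heights `2⁻ⁿ`. -/
def dyadic : StepBilliard where
  p n := (1 / 2) ^ n
  p_zero := pow_zero _
  p_pos n := by positivity
  p_antitone := pow_right_anti₀ (by norm_num) (by norm_num)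
  p_tendsto := tendsto_pow_atTop_nhds_zero_of_lt_one (by norm_num) (by norm_num)

theorem wrap_eq_of_mem {k : ℤ} {y y' : ℝ} (h : y' ∈ B.fiber k) (m : ℤ)
    (hm : y = y' + m * (2 * B.height k)) : B.wrap k y = y' := by
  rw [← B.wrap_of_mem h]
  simp only [wrap]
  rw [toIcoMod_eq_toIcoMod]
  exact ⟨-m, by rw [hm, zsmul_eq_mul]; push_cast; ring⟩

theorem dyadic_height_zero : dyadic.height 0 = 1 := pow_zero _

theorem dyadic_height_neg_one : dyadic.height (-1) = 1 := pow_zero _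

theorem dyadic_height_succ (n : ℕ) : dyadic.height (n + 1 : ℤ) = (1 / 2) ^ (n + 1) := rfl

/-- The ordinate `5 / 4` wraps to `-3 / 4`, which is beyond the opening of height `1 / 2` at
abscissa `1`, so the wall sends the point to column `-1`. -/
theorem dyadic_crossMap_quarter :
    dyadic.crossMap (Real.pi / 4) (0, 1 / 4) = (-1, -3 / 4) := by
  have hw : dyadic.wrap 0 (1 / 4 + 1) = -3 / 4 := by
    refine wrap_eq_of_mem ?_ 1 ?_
    · rw [fiber, dyadic_height_zero]
      constructor <;> norm_num
    · rw [dyadic_height_zero]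
      norm_num
  have hn : (-3 / 4 : ℝ) ∉ dyadic.fiber (0 + 1) := by
    have := dyadic_height_succ 0
    rw [Nat.cast_zero] at this
    rw [fiber, this]
    norm_num
  rw [crossMap_of_notMem (by rwa [Real.tan_pi_div_four]) hn, zero_add]

theorem dyadic_crossMap_neg_three_quarters :
    dyadic.crossMap (Real.pi / 4) (-1, -3 / 4) = (0, 1 / 4) := by
  have hw : dyadic.wrap (-1) (-3 / 4 + 1) = 1 / 4 := by
    refine wrap_eq_of_mem ?_ 0 (by norm_num)
    rw [fiber, dyadic_height_neg_one]
    constructor <;> norm_num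
  have hm : (1 / 4 : ℝ) ∈ dyadic.fiber (-1 + 1) := by
    rw [neg_add_cancel, fiber, dyadic_height_zero]
    constructor <;> norm_num
  rw [crossMap_of_mem (by rwa [Real.tan_pi_div_four]) hm, neg_add_cancel]

theorem dyadic_crossMap_axis (n : ℕ) :
    dyadic.crossMap (Real.pi / 4) ((n + 1 : ℤ), 0) = ((n + 1 : ℤ) + 1, 0) := by
  have h0 : ∀ k, (0 : ℝ) ∈ dyadic.fiber k := fun k =>
    ⟨neg_nonpos.mpr (dyadic.height_pos k).le, dyadic.height_pos k⟩
  have hw : dyadic.wrap (n + 1 : ℤ) (0 + 1) = 0 := by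
    -- The unit rise is exactly `2 ^ n` circumferences `2 * (1 / 2) ^ (n + 1)`.
    refine wrap_eq_of_mem (h0 _) (2 ^ n) ?_
    rw [dyadic_height_succ, pow_succ]
    push_cast
    have : (2 : ℝ) ^ n * (1 / 2) ^ n = 1 := by rw [← mul_pow]; norm_num
    linear_combination -this
  exact crossMap_of_mem (by rwa [Real.tan_pi_div_four]) (h0 _)

theorem cos_pi_div_four_pos : 0 < Real.cos (Real.pi / 4) :=
  cos_pos_of_mem ⟨by linarith [Real.pi_pos], by linarith [Real.pi_pos]⟩

theorem dyadic_exists_isPeriodic : ∃ z : dyadic.Surface, dyadic.IsPeriodic (Real.pi / 4) z := by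
  have hf : (1 / 4 : ℝ) ∈ dyadic.fiber 0 := by
    rw [fiber, dyadic_height_zero]
    constructor <;> norm_num
  let z : dyadic.Surface := ⟨((0 : ℝ), 1 / 4), by simpa using hf⟩
  have hs : (z.start (Real.pi / 4)).1 = (0, 1 / 4) := by
    simp only [Surface.start, z, Int.floor_zero, Int.fract_zero, zero_mul, sub_zero]
    rw [dyadic.wrap_of_mem hf]
  have h2 : ((dyadic.cross (Real.pi / 4) ^ (2 : ℤ)) (z.start (Real.pi / 4))).1 = (0, 1 / 4) := by
    have e1 := dyadic.coe_cross_zpow_add_one (Real.pi / 4) 0 (z.start (Real.pi / 4))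
    have e2 := dyadic.coe_cross_zpow_add_one (Real.pi / 4) 1 (z.start (Real.pi / 4))
    rw [zpow_zero, Equiv.Perm.one_apply, hs, dyadic_crossMap_quarter, zero_add] at e1
    rwa [e1, dyadic_crossMap_neg_three_quarters, one_add_one_eq_two] at e2
  refine ⟨z, 2 / Real.cos (Real.pi / 4), div_pos two_pos cos_pi_div_four_pos, Subtype.ext ?_⟩
  rw [coe_flow (i := 2) (r := 0) _ _ z ⟨le_rfl, one_pos⟩, h2]
  · simp only [zero_mul, add_zero, Int.cast_zero]
    rw [dyadic.wrap_of_mem hf]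
  · rw [div_mul_cancel₀ _ cos_pi_div_four_pos.ne']
    simp [z]

theorem dyadic_exists_unbounded :
    ∃ w : dyadic.Surface, ¬ Bornology.IsBounded (dyadic.trajectory (Real.pi / 4) w) := by
  have hf : (0 : ℝ) ∈ dyadic.fiber 1 :=
    ⟨neg_nonpos.mpr (dyadic.height_pos 1).le, dyadic.height_pos 1⟩
  -- The start is in column `1`: in column `0` the unit rise is only half a circumference.
  let w : dyadic.Surface := ⟨((1 : ℝ), 0), by simpa using hf⟩
  have hs : (w.start (Real.pi / 4)).1 = (1, 0) := by
    simp only [Surface.start, w, Int.floor_one, Int.fract_one, zero_mul, sub_zero]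
    rw [dyadic.wrap_of_mem hf]
  have hn : ∀ n : ℕ, ((dyadic.cross (Real.pi / 4) ^ (n : ℤ)) (w.start (Real.pi / 4))).1 =
      ((n + 1 : ℤ), 0) := by
    intro n
    induction n with
    | zero => simpa using hs
    | succ n ih =>
      push_cast
      rw [coe_cross_zpow_add_one, ih, dyadic_crossMap_axis]
  refine ⟨w, fun hb => ?_⟩
  obtain ⟨N, hN⟩ := exists_eventually_abs_le (F := atTop) hb cos_pi_div_four_pos.ne' w
    (.of_forall fun i => ⟨_, rfl⟩)
  obtain ⟨M, hM⟩ := eventually_atTop.mp hN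
  have h := hM ((max M N).toNat : ℤ) ((le_max_left _ _).trans (Int.self_le_toNat _))
  rw [hn] at h
  have h1 := (le_abs_self _).trans h
  have h2 := (le_max_right M N).trans (Int.self_le_toNat _)
  simp only at h1
  omega

end StepBilliard

end

theorem mainTheorem10 :
    (∀ B : StepBilliard, ∀ᵐ θ ∂(volume.restrict (Ioo (0 : ℝ) (Real.pi / 2))),
      ∀ z : B.Surface,
        ¬ Bornology.IsBounded (B.forwardSemiOrbit θ z) ∧
        ¬ Bornology.IsBounded (B.backwardSemiOrbit θ z)) ∧
    (∀ B : StepBilliard,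
      volume {θ : ℝ | θ ∈ Ioo (0 : ℝ) (Real.pi / 2) ∧ B.PeriodicUnboundedCoexist θ} = 0) ∧
    (∃ B : StepBilliard, ∃ θ ∈ Ioo (0 : ℝ) (Real.pi / 2), B.PeriodicUnboundedCoexist θ) := by
  refine ⟨fun B => ?_, fun B => ?_, StepBilliard.dyadic, Real.pi / 4, ?_,
    StepBilliard.dyadic_exists_isPeriodic, StepBilliard.dyadic_exists_unbounded⟩
  · rw [ae_restrict_iff' measurableSet_Ioo]
    filter_upwards [B.countable_not_isFreeDirection.ae_notMem volume] with θ hθ hmem z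
    have hfree : B.IsFreeDirection θ := by
      by_contra h
      exact hθ ⟨hmem, h⟩
    exact ⟨hfree.not_isBounded_forwardSemiOrbit (StepBilliard.cos_pos_of_mem hmem) z,
      hfree.not_isBounded_backwardSemiOrbit (StepBilliard.cos_pos_of_mem hmem) z⟩
  · refine measure_mono_null ?_ (B.countable_not_isFreeDirection.measure_zero volume)
    rintro θ ⟨hmem, ⟨z, hz⟩, -⟩
    exact ⟨hmem, fun hfree => hfree.not_isPeriodic (StepBilliard.cos_pos_of_mem hmem) z hz⟩
  · constructor <;> linarith [Real.pi_pos]
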